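/- Let $q\ge 4$ be a prime power and let $\mathrm{PG}(2,q)$ be the Desarguesian projective plane over the field with $q$ elements. In its incidence graph (vertices: the points and the lines; a point and a line are adjacent if and only if they are incident), let $d$ denote the graph distance. A set $S=\{P_1,\dots,P_n\}$ of points is called semi-resolving if distinct lines $\ell$ have distinct ordered distance lists $(d(\ell,P_1),\dots,d(\ell,P_n))$. A set $B$ of points is called a double blocking set if every line contains at least two points of $B$. Theorem. If $S$ is a semi-resolving set of points in $\mathrm{PG}(2,q)$ with $|S|<2q+\frac q4-3$, then there is a set $T$ of at most two points such that $S\cup T$ is a double blocking set. -/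

import Mathlib

namespace ProjPlane

/-- The incidence graph of a point-line geometry: bipartite on points and lines, with a point and
a line adjacent iff they are incident. -/
def incidenceGraph (P L : Type*) [Membership P L] : SimpleGraph (P ⊕ L) where
  Adj x y := ∃ (p : P) (l : L), p ∈ l ∧
    ((x = Sum.inl p ∧ y = Sum.inr l) ∨ (x = Sum.inr l ∧ y = Sum.inl p))
  symm := ⟨by
    rintro x y ⟨p, l, h, h' | h'⟩
    · exact ⟨p, l, h, Or.inr ⟨h'.2, h'.1⟩⟩
    · exact ⟨p, l, h, Or.inl ⟨h'.2, h'.1⟩⟩⟩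
  loopless := ⟨by
    rintro x ⟨p, l, -, ⟨rfl, h⟩ | ⟨rfl, h⟩⟩ <;> simp at h⟩

/-- A point-set `S` is semi-resolving if every line is determined, among all lines, by its list of
distances (in the incidence graph) from the points of `S`. -/
def IsSemiResolving {P : Type*} (L : Type*) [Membership P L] (S : Set P) : Prop :=
  ∀ l m : L,
    (∀ p ∈ S, (incidenceGraph P L).dist (Sum.inr l) (Sum.inl p) =
      (incidenceGraph P L).dist (Sum.inr m) (Sum.inl p)) → l = m

/-- A point-set `B` is a double blocking set if every line contains at least two points of `B`. -/
def IsDoubleBlocking {P : Type*} (L : Type*) [Membership P L] (B : Set P) : Prop :=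
  ∀ l : L, 2 ≤ {p | p ∈ B ∧ p ∈ l}.encard

/-- The point set of the Desarguesian projective plane over `K`: one-dimensional subspaces
of `K ^ 3`. -/
abbrev PGPoint (K : Type*) [Field K] : Type _ := Projectivization K (Fin 3 → K)

/-- The lines of the Desarguesian projective plane over `K`, in homogeneous line coordinates; the
incidence `p ∈ l` is Mathlib's `Configuration.ofField` one: the dot product of the point
coordinates of `p` with the line coordinates of `l` is zero. -/
abbrev PGLine (K : Type*) [Field K] : Type _ := Projectivization K (Fin 3 → K)

end ProjPlane

/-!
A line and a point are at distance `1` or `3`, so a point set `S` is semi-resolving iff distinct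
lines have distinct traces on `S`.  For traces with at most one point this means that at most one
line is skew to `S` and at most one tangent passes through each point of `S`.  Give skew lines the
deficiency `2`, tangents `1` and all other lines `0`, let the index `k` of a point be the sum of the
deficiencies of the lines through it, and let `T` be the sum of all deficiencies, so that
`T ≤ |S| + 2`.

The main step is the quadratic inequality `k * (3 * q + 1 - |S| - k) ≤ T` for the points outside `S`
(`AffineChart.index_mul_le`).  Move such a point to infinity, on a line with at least two points of
`S`, one of which becomes the vertical direction.  The polynomial
`u(X, m) = ∏ (X + a * m - b)` over the affine points `(a, b)` of `S` is, for a fixed slope `m`, the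
product of the factors belonging to the lines of slope `m`, so the index of the direction `m` is
the degree of `v / gcd (u(X, m), v)` for `v = ∏ (X - b) ^ 2`, the last product being over the field.
At the given point this degree is `k`.  Consider the subresultant of `u` and `v` of size `k` as a
polynomial in `m`: it does not vanish at the given direction
(`eval_det_remainderMatrix_ne_zero`), a direction of index `k' < k` is a root of multiplicity at
least `k - k'` (`pow_dvd_det_remainderMatrix`), and its degree is at most `k * (N + k - 2 * q)` for
`N` affine points (`natDegree_det_remainderMatrix_le`).  Counting the roots that are directions
outside `S`, whose indices add up to at most `T`, gives the inequality.

For `|S| < 9 * q / 4 - 3` the inequality says that each index outside `S` is either at most `2` or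
at least `3 * q - 1 - |S|`.  Since `T ≤ |S| + 2`, at most two points have a large index.  Every
tangent contains one of them (`exists_three_le_index_of_tangent`), and if there is a skew line,
every tangent even meets it in one of them, because the skew line alone contributes `2`.  Hence it
suffices to add the points of large index, or, if there is a skew line, two of its points that
include those of large index on it (`exists_doubly_blocking_extension`).
-/

/-! ### Subresultants modulo a polynomial with constant coefficients -/

section Remainder

open Polynomial

/-- The matrix of leading coefficients of remainders: row `j` lists the coefficients of degrees
`s, …, s + e - 1` (as polynomials in the parameter) of the remainder of `u * X ^ j` modulo the
constant-coefficient polynomial `v`.  When `v` has degree `s + e`, its determinant plays the role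
of a subresultant of `u` and `v`. -/
noncomputable def remainderMatrix {K : Type*} [Field K] (u : K[X][X]) (v : K[X]) (s e : ℕ) :
    Matrix (Fin e) (Fin e) K[X] :=
  Matrix.of fun j k => ((u * X ^ (j : ℕ)) %ₘ v.map C).coeff (s + k)

variable {K : Type*} [Field K]

lemma coeff_mul_map_modByMonic (u : K[X][X]) (v p : K[X]) (e n : ℕ) (hp : p.natDegree < e) :
    ((u * p.map C) %ₘ v.map C).coeff n =
      ∑ j : Fin e, C (p.coeff j) * ((u * X ^ (j : ℕ)) %ₘ v.map C).coeff n := by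
  have h1 : u * p.map C = ∑ j : Fin e, C (p.coeff j) • (u * X ^ (j : ℕ)) := by
    conv_lhs => rw [as_sum_range' p e hp, Polynomial.map_sum, Finset.mul_sum,
      ← Fin.sum_univ_eq_sum_range (fun i => u * (monomial i (p.coeff i)).map C)]
    refine Finset.sum_congr rfl fun j _ => ?_
    rw [map_monomial, smul_eq_C_mul, ← C_mul_X_pow_eq_monomial]
    ring
  have h2 : ∀ w : K[X][X], w %ₘ v.map C = modByMonicHom (v.map C) w := fun _ => rfl
  rw [h1, h2, map_sum, finsetSum_coeff]
  refine Finset.sum_congr rfl fun j _ => ?_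
  rw [map_smul, coeff_smul, smul_eq_mul, h2]

/-- Replacing the powers of `X` by any monic polynomials of the same degrees is a unitriangular
row operation, hence does not change the determinant. -/
lemma det_remainderMatrix_eq (u : K[X][X]) (v : K[X]) (s e : ℕ) (p : Fin e → K[X])
    (hp : ∀ j, (p j).Monic) (hdeg : ∀ j, (p j).natDegree = j) :
    (remainderMatrix u v s e).det =
      (Matrix.of fun (j k : Fin e) => ((u * (p j).map C) %ₘ v.map C).coeff (s + k)).det := by
  let T : Matrix (Fin e) (Fin e) K[X] := Matrix.of fun j i => C ((p j).coeff i)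
  have hT : T.det = 1 := by
    rw [Matrix.det_of_isLowerTriangular]
    · refine Finset.prod_eq_one fun j _ => ?_
      have : (p j).coeff j = 1 := by
        have := hp j
        rwa [Monic, leadingCoeff, hdeg] at this
      simp [T, this]
    · intro i j hij
      have hij : (i : ℕ) < j := by simpa using hij
      simp [T, coeff_eq_zero_of_natDegree_lt (hdeg i ▸ hij)]
  have : (Matrix.of fun (j k : Fin e) => ((u * (p j).map C) %ₘ v.map C).coeff (s + k)) =
      T * remainderMatrix u v s e := by
    ext1 j k
    rw [Matrix.mul_apply, Matrix.of_apply,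
      coeff_mul_map_modByMonic u v (p j) e _ (by rw [hdeg]; exact j.2)]
    rfl
  rw [this, Matrix.det_mul, hT, one_mul]

lemma eval_coeff_modByMonic (w : K[X][X]) (v : K[X]) (hv : v.Monic) (y : K) (n : ℕ) :
    ((w %ₘ v.map C).coeff n).eval y = ((w.map (evalRingHom y)) %ₘ v).coeff n := by
  have := map_modByMonic (p := w) (q := v.map C) (evalRingHom y) (hv.map C)
  rw [map_map] at this
  have h : (evalRingHom y).comp C = RingHom.id K := by ext; simp
  rw [h, map_id] at this
  rw [← this, coeff_map]
  rfl

/-- If `f` is monic and `v` divides `f * u` at the parameter value `y`, then the multiples of `f`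
yield `e - deg f` independent vectors in the kernel at `y`, whence the multiplicity of the root
`y` of the determinant. -/
lemma pow_dvd_det_remainderMatrix (u : K[X][X]) (v : K[X]) (hv : v.Monic) (s e : ℕ) (y : K)
    (f : K[X]) (hf : f.Monic) (hdvd : v ∣ f * u.map (evalRingHom y)) :
    (X - C y) ^ (e - f.natDegree) ∣ (remainderMatrix u v s e).det := by
  -- replace the powers `X ^ j` by multiples of `f` from degree `deg f` on
  let p : Fin e → K[X] := fun j =>
    if f.natDegree ≤ j then X ^ ((j : ℕ) - f.natDegree) * f else X ^ (j : ℕ)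
  have hp : ∀ j, (p j).Monic := fun j => by
    by_cases h : f.natDegree ≤ j
    · simpa only [p, if_pos h] using (monic_X_pow _).mul hf
    · simpa only [p, if_neg h] using monic_X_pow _
  have hdeg : ∀ j, (p j).natDegree = j := fun j => by
    by_cases h : f.natDegree ≤ j
    · simp only [p, if_pos h]
      rw [(monic_X_pow _).natDegree_mul hf, natDegree_X_pow]
      omega
    · simp only [p, if_neg h, natDegree_X_pow]
  rw [det_remainderMatrix_eq u v s e p hp hdeg]
  have key : ∀ j k : Fin e, ∃ c : K[X], ((u * (p j).map C) %ₘ v.map C).coeff (s + k) =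
      (if f.natDegree ≤ j then X - C y else 1) * c := fun j k => by
    by_cases h : f.natDegree ≤ j
    · rw [if_pos h]
      refine dvd_iff_exists_eq_mul_right.1 ?_
      rw [dvd_iff_isRoot, IsRoot, eval_coeff_modByMonic _ _ hv]
      have h0 : ((u * (p j).map C).map (evalRingHom y)) %ₘ v = 0 := by
        rw [modByMonic_eq_zero_iff_dvd hv, Polynomial.map_mul, map_map]
        have h' : (evalRingHom y).comp C = RingHom.id K := by ext; simp
        rw [h', map_id]
        simp only [p, if_pos h]
        rw [mul_comm, mul_assoc]
        exact hdvd.mul_left _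
      rw [h0, coeff_zero]
    · exact ⟨_, by rw [if_neg h, one_mul]⟩
  choose c hc using key
  simp only [hc]
  rw [Matrix.det_mul_column (fun j : Fin e => if f.natDegree ≤ j then X - C y else 1)
    (fun j k => c j k)]
  refine Dvd.dvd.mul_right ?_ _
  rw [Finset.prod_ite, Finset.prod_const, Finset.prod_const_one, mul_one]
  refine dvd_of_eq (congrArg _ ?_)
  have h := Fin.card_filter_val_lt (n := e) (m := f.natDegree)
  have h2 := Finset.card_filter_add_card_filter_not (s := (Finset.univ : Finset (Fin e)))
    (fun x => (x : ℕ) < f.natDegree)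
  simp only [not_lt, Finset.card_univ, Fintype.card_fin] at h2
  omega

/-- The determinant does not vanish at a parameter value where the cofactor `f` of the greatest
common divisor of `u` and `v` has degree exactly `e`. -/
lemma eval_det_remainderMatrix_ne_zero (u : K[X][X]) (v : K[X]) (hv : v.Monic) (s e : ℕ)
    (hd : v.natDegree = s + e) (y : K) (f : K[X]) (hfe : f.natDegree = e) (hf : f.Monic)
    (hdvd : v ∣ f * u.map (evalRingHom y)) (hmin : ∀ a, v ∣ a * u.map (evalRingHom y) → f ∣ a) :
    (remainderMatrix u v s e).det.eval y ≠ 0 := by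
  intro h0
  rw [← coe_evalRingHom, RingHom.map_det, ← Matrix.exists_vecMul_eq_zero_iff] at h0
  obtain ⟨c, hc0, hc⟩ := h0
  let a : K[X] := ∑ j : Fin e, monomial (j : ℕ) (c j)
  have hacoeff : ∀ j : Fin e, a.coeff j = c j := fun j => by
    simp only [a, finsetSum_coeff, coeff_monomial]
    rw [Finset.sum_eq_single j]
    · simp
    · intro i _ hij
      rw [if_neg (fun h => hij (Fin.ext h))]
    · simp
  have hadeg : a.degree < e := by
    refine (degree_sum_le _ _).trans_lt ?_
    refine (Finset.sup_lt_iff (WithBot.bot_lt_coe e)).2 ?_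
    exact fun j _ => (degree_monomial_le _ _).trans_lt (Nat.cast_lt.2 j.2)
  set w := u.map (evalRingHom y) with hw
  set r := (w * a) %ₘ v with hr
  have hrcoeff : ∀ k : Fin e, r.coeff (s + k) = 0 := fun k => by
    have he : a.natDegree < e := by
      rcases eq_or_ne a 0 with h | h
      · rw [h, natDegree_zero]; exact k.pos
      · exact (natDegree_lt_iff_degree_lt h).2 hadeg
    have h1 := coeff_mul_map_modByMonic u v a e (s + k) he
    have h2 := congrArg (eval y) h1
    rw [eval_coeff_modByMonic _ _ hv, Polynomial.map_mul, map_map] at h2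
    have h' : (evalRingHom y).comp C = RingHom.id K := by ext; simp
    rw [h', map_id, eval_finsetSum] at h2
    rw [hr, h2]
    refine Eq.trans ?_ (congrFun hc k)
    simp only [Matrix.vecMul, dotProduct]
    refine Finset.sum_congr rfl fun j _ => ?_
    rw [eval_mul, eval_C, hacoeff]
    rfl
  have hrdeg : r.degree < s := by
    rw [degree_lt_iff_coeff_zero]
    intro n hn
    by_cases h : n < s + e
    · have := hrcoeff ⟨n - s, by omega⟩
      simpa [Nat.add_sub_cancel' hn] using this
    · refine coeff_eq_zero_of_degree_lt ((degree_modByMonic_lt _ hv).trans_le ?_)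
      rw [degree_eq_natDegree hv.ne_zero, hd]
      exact_mod_cast not_lt.1 h
  -- `v` divides `f * r`, whose degree is less than that of `v`
  have hfr : f * r = 0 := by
    refine eq_zero_of_dvd_of_degree_lt (p := v) ?_ ?_
    · rw [hr, modByMonic_eq_sub_mul_div _ v, mul_sub]
      refine dvd_sub ?_ ?_
      · rw [← mul_assoc]; exact hdvd.mul_right a
      · exact ((dvd_mul_right v _).mul_left f)
    · rw [degree_mul, degree_eq_natDegree hf.ne_zero, degree_eq_natDegree hv.ne_zero, hd, hfe,
        add_comm s e, Nat.cast_add]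
      exact WithBot.add_lt_add_left (by simp) hrdeg
  have hr0 : r = 0 := (mul_eq_zero.1 hfr).resolve_left hf.ne_zero
  have hfa : f ∣ a := hmin a (by rw [mul_comm]; exact (modByMonic_eq_zero_iff_dvd hv).1 hr0)
  have ha0 : a = 0 := eq_zero_of_dvd_of_degree_lt hfa
    (by rw [degree_eq_natDegree hf.ne_zero, hfe]; exact hadeg)
  exact hc0 (funext fun j => by rw [← hacoeff, ha0]; simp)

lemma degree_coeff_modByMonic_le (u : K[X][X]) (v : K[X]) (hv : v.Monic) (N : ℕ)
    (hu : ∀ i, (u.coeff i).degree + i ≤ N) (j k : ℕ) :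
    (((u * X ^ j) %ₘ v.map C).coeff k).degree + (k : WithBot ℕ) ≤ ((N + j : ℕ) : WithBot ℕ) := by
  have h2 : ∀ w : K[X][X], w %ₘ v.map C = modByMonicHom (v.map C) w := fun _ => rfl
  have h1 : u * X ^ j = ∑ i ∈ Finset.range (u.natDegree + 1), u.coeff i • X ^ (i + j) := by
    conv_lhs => rw [as_sum_range_C_mul_X_pow u, Finset.sum_mul]
    refine Finset.sum_congr rfl fun i _ => ?_
    rw [smul_eq_C_mul, mul_assoc, ← pow_add]
  have h3 : ∀ n, (X ^ n : K[X][X]) %ₘ v.map C = ((X ^ n : K[X]) %ₘ v).map C := fun n => by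
    rw [map_modByMonic _ hv, Polynomial.map_pow, map_X]
  rw [h1, h2, map_sum, finsetSum_coeff]
  simp only [map_smul]
  simp only [← h2, h3, coeff_smul, coeff_map, smul_eq_mul]
  rcases lt_or_ge (N + j) k with hk | hk
  · rw [Finset.sum_eq_zero, degree_zero, WithBot.bot_add]
    · exact bot_le
    intro i _
    by_cases hi : u.coeff i = 0
    · rw [hi, zero_mul]
    · have : ((X ^ (i + j) : K[X]) %ₘ v).coeff k = 0 := by
        refine coeff_eq_zero_of_degree_lt (degree_modByMonic_le_left.trans_lt ?_)
        rw [degree_X_pow]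
        have := hu i
        rw [degree_eq_natDegree hi] at this
        norm_cast at this ⊢
        omega
      rw [this, C_0, mul_zero]
  · have : ∀ i ∈ Finset.range (u.natDegree + 1),
        (u.coeff i * C (((X ^ (i + j) : K[X]) %ₘ v).coeff k)).degree ≤ (N + j - k : ℕ) := by
      intro i _
      by_cases hi : u.coeff i = 0
      · rw [hi, zero_mul, degree_zero]; exact bot_le
      by_cases hk' : i + j < k
      · have : ((X ^ (i + j) : K[X]) %ₘ v).coeff k = 0 := by
          refine coeff_eq_zero_of_degree_lt (degree_modByMonic_le_left.trans_lt ?_)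
          rw [degree_X_pow]
          exact_mod_cast hk'
        rw [this, C_0, mul_zero, degree_zero]; exact bot_le
      · refine degree_mul_le_of_le (b := 0) le_rfl degree_C_le |>.trans ?_
        have := hu i
        rw [degree_eq_natDegree hi] at this ⊢
        norm_cast at this ⊢
        rw [add_zero]
        omega
    have h4 := (degree_sum_le _ _).trans (Finset.sup_le this)
    refine (add_le_add_left h4 (k : WithBot ℕ)).trans ?_
    norm_cast
    omega

lemma natDegree_det_remainderMatrix_le (u : K[X][X]) (v : K[X]) (hv : v.Monic) (N s e : ℕ)
    (hu : ∀ i, (u.coeff i).degree + i ≤ N) (h0 : (remainderMatrix u v s e).det ≠ 0) :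
    (remainderMatrix u v s e).det.natDegree + e * s ≤ e * N := by
  have hterm : ∀ σ : Equiv.Perm (Fin e),
      (∏ i, remainderMatrix u v s e (σ i) i).degree + ((e * s : ℕ) : WithBot ℕ) ≤
        ((e * N : ℕ) : WithBot ℕ) := by
    intro σ
    by_cases hz : ∏ i, remainderMatrix u v s e (σ i) i = 0
    · rw [hz, degree_zero, WithBot.bot_add]; exact bot_le
    rw [degree_eq_natDegree hz]
    rw [← ne_eq, Finset.prod_ne_zero_iff] at hz
    rw [natDegree_prod _ _ hz]
    norm_cast
    have h1 : ∀ i : Fin e, (remainderMatrix u v s e (σ i) i).natDegree + (s + (i : ℕ)) ≤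
        N + (σ i : ℕ) := fun i => by
      have := degree_coeff_modByMonic_le u v hv N hu (σ i) (s + i)
      have hne := hz i (Finset.mem_univ i)
      change (remainderMatrix u v s e (σ i) i).degree + _ ≤ _ at this
      rw [degree_eq_natDegree hne] at this
      exact_mod_cast this
    have h2 := Finset.sum_le_sum fun i (_ : i ∈ Finset.univ) => h1 i
    simp only [Finset.sum_add_distrib, Finset.sum_const, Finset.card_univ, Fintype.card_fin,
      smul_eq_mul] at h2
    rw [Equiv.sum_comp σ (fun i : Fin e => (i : ℕ))] at h2
    omega
  have hle : (remainderMatrix u v s e).det.degree ≤ (e * N - e * s : ℕ) := by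
    rw [Matrix.det_apply]
    refine (degree_sum_le _ _).trans (Finset.sup_le fun σ _ => ?_)
    refine (degree_smul_le _ _).trans ?_
    by_cases hz : ∏ i, remainderMatrix u v s e (σ i) i = 0
    · rw [hz, degree_zero]; exact bot_le
    have := hterm σ
    rw [degree_eq_natDegree hz] at this ⊢
    norm_cast at this ⊢
    omega
  have hN : e * s ≤ e * N := by
    by_contra hlt
    refine h0 ?_
    rw [Matrix.det_apply]
    refine Finset.sum_eq_zero fun σ _ => ?_
    by_cases hz : ∏ i, remainderMatrix u v s e (σ i) i = 0
    · rw [hz, smul_zero]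
    have := hterm σ
    rw [degree_eq_natDegree hz] at this
    norm_cast at this
    omega
  rw [degree_eq_natDegree h0] at hle
  norm_cast at hle
  omega

/-- A form of the Szőnyi–Weiner lemma, for a second polynomial `v` that does not depend on the
parameter.  The degree of the cofactor `f y = v / gcd (u(y), v)` at a fixed parameter value `y₀`
controls by how much it can drop at the other parameter values. -/
theorem sum_natDegree_sub_le (u : K[X][X]) (v : K[X]) (hv : v.Monic) (N s e : ℕ)
    (hd : v.natDegree = s + e) (hu : ∀ i, (u.coeff i).degree + i ≤ N) (f : K → K[X])
    (hf : ∀ y, (f y).Monic) (hdvd : ∀ y, v ∣ f y * u.map (evalRingHom y)) (y₀ : K)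
    (he : (f y₀).natDegree = e) (hmin : ∀ a, v ∣ a * u.map (evalRingHom y₀) → f y₀ ∣ a)
    (Y : Finset K) :
    ∑ y ∈ Y, (e - (f y).natDegree) + e * s ≤ e * N := by
  have hev := eval_det_remainderMatrix_ne_zero u v hv s e hd y₀ (f y₀) he (hf y₀) (hdvd y₀) hmin
  have h0 : (remainderMatrix u v s e).det ≠ 0 := fun h => hev (by rw [h, eval_zero])
  have hprod : ∏ y ∈ Y, (X - C y) ^ (e - (f y).natDegree) ∣ (remainderMatrix u v s e).det :=
    Finset.prod_dvd_of_coprime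
      (fun a _ b _ hab => (pairwise_coprime_X_sub_C Function.injective_id hab).pow)
      fun y _ => pow_dvd_det_remainderMatrix u v hv s e y (f y) (hf y) (hdvd y)
  have hle := natDegree_le_of_dvd hprod h0
  rw [natDegree_prod_of_monic _ _ fun y _ => (monic_X_sub_C y).pow _] at hle
  simp only [(monic_X_sub_C _).natDegree_pow, natDegree_X_sub_C, mul_one] at hle
  have := natDegree_det_remainderMatrix_le u v hv N s e hu h0
  omega

end Remainder

/-! ### Affine point sets and their deficiencies by slope -/

section Affine

open Polynomial

variable {K : Type*} [Field K]

/-- The polynomial `∏ (X + a * M - b)` over the points `(a, b)` of `A`, in the unknown `X` with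
parameter `M`.  At `M = m` its roots are the intercepts of the lines of slope `m` that
meet `A`, each repeated as often as the line has points in `A`. -/
noncomputable def redeiPolynomial (A : Finset (K × K)) : K[X][X] :=
  ∏ z ∈ A, (X + C (C z.1 * X - C z.2))

lemma degree_coeff_redeiPolynomial_add_le (A : Finset (K × K)) (i : ℕ) :
    ((redeiPolynomial A).coeff i).degree + i ≤ (A.card : WithBot ℕ) := by
  classical
  induction A using Finset.induction_on generalizing i with
  | empty =>
    rw [redeiPolynomial, Finset.prod_empty, coeff_one]
    split_ifs with h
    · subst h; simp
    · simp
  | insert z A hz ih =>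
    have hR : redeiPolynomial (insert z A) =
        X * redeiPolynomial A + C (C z.1 * X - C z.2) * redeiPolynomial A := by
      rw [redeiPolynomial, Finset.prod_insert hz, add_mul]; rfl
    have hlin : (C z.1 * X - C z.2 : K[X]).degree ≤ 1 := by
      rw [sub_eq_add_neg, ← C_neg]; exact degree_linear_le
    rw [hR, coeff_add, coeff_C_mul, Finset.card_insert_of_notMem hz]
    have h1 : ((X * redeiPolynomial A).coeff i).degree + (i : WithBot ℕ) ≤
        ((A.card + 1 : ℕ) : WithBot ℕ) := by
      cases i with
      | zero => simp
      | succ i =>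
        rw [coeff_X_mul]
        push_cast
        rw [← add_assoc]
        gcongr
        exact ih i
    have h2 : ((C z.1 * X - C z.2) * (redeiPolynomial A).coeff i).degree + (i : WithBot ℕ) ≤
        ((A.card + 1 : ℕ) : WithBot ℕ) := by
      rw [degree_mul, add_assoc, add_comm]
      push_cast
      exact add_le_add (ih i) hlin
    rcases le_total ((X * redeiPolynomial A).coeff i).degree
      ((C z.1 * X - C z.2) * (redeiPolynomial A).coeff i).degree with h | h
    · exact (add_le_add ((degree_add_le _ _).trans (max_le h le_rfl)) le_rfl).trans h2
    · exact (add_le_add ((degree_add_le _ _).trans (max_le le_rfl h)) le_rfl).trans h1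

lemma map_redeiPolynomial (A : Finset (K × K)) (m : K) :
    (redeiPolynomial A).map (evalRingHom m) = ∏ z ∈ A, (X - C (z.2 - z.1 * m)) := by
  rw [redeiPolynomial, Polynomial.map_prod]
  refine Finset.prod_congr rfl fun z _ => ?_
  simp only [Polynomial.map_add, map_X, map_C, coe_evalRingHom, eval_sub, eval_mul, eval_C, eval_X]
  rw [← neg_sub, C_neg]
  ring

lemma natDegree_prod_X_sub_C_pow [Fintype K] (g : K → ℕ) :
    (∏ b : K, (X - C b) ^ g b).natDegree = ∑ b : K, g b := by
  rw [natDegree_prod_of_monic _ _ fun y _ => (monic_X_sub_C y).pow _]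
  simp only [(monic_X_sub_C _).natDegree_pow, natDegree_X_sub_C, mul_one]

variable [Fintype K] [DecidableEq K]

/-- The number of points of `A` on the affine line of slope `m` and intercept `b`. -/
def affineCount (A : Finset (K × K)) (m b : K) : ℕ :=
  (A.filter fun z => z.2 = m * z.1 + b).card

lemma map_redeiPolynomial_eq_prod_pow (A : Finset (K × K)) (m : K) :
    (redeiPolynomial A).map (evalRingHom m) = ∏ b : K, (X - C b) ^ affineCount A m b := by
  rw [map_redeiPolynomial,
    ← Finset.prod_fiberwise (s := A) (g := fun z => z.2 - z.1 * m)]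
  refine Finset.prod_congr rfl fun b _ => ?_
  rw [Finset.prod_congr rfl (g := fun _ => X - C b)
    (fun z hz => by rw [(Finset.mem_filter.1 hz).2]), Finset.prod_const, affineCount]
  refine congrArg _ (congrArg _ (Finset.filter_congr fun z _ => ?_))
  rw [sub_eq_iff_eq_add, mul_comm, add_comm]

/-- If `e m` is the total number of points that the lines of slope `m` lack of being doubly
blocked by `A`, then `∑ (e m₀ - e m) ≤ e m₀ * (|A| + e m₀ - 2 * q)`, the sum being over those `m`
for which the difference is positive. -/
theorem sum_deficiency_sub_le (A : Finset (K × K)) (m₀ : K) (Y : Finset K) :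
    ∑ m ∈ Y, ((∑ b, (2 - affineCount A m₀ b)) - ∑ b, (2 - affineCount A m b)) +
      (∑ b, (2 - affineCount A m₀ b)) * (2 * Fintype.card K - ∑ b, (2 - affineCount A m₀ b)) ≤
      (∑ b, (2 - affineCount A m₀ b)) * A.card := by
  set f : K → K[X] := fun m => ∏ b : K, (X - C b) ^ (2 - affineCount A m b) with hfdef
  have hfdeg : ∀ m, (f m).natDegree = ∑ b, (2 - affineCount A m b) := fun m =>
    natDegree_prod_X_sub_C_pow _
  set v : K[X] := ∏ b : K, (X - C b) ^ 2 with hvdef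
  have hv : v.Monic := monic_prod_of_monic _ _ fun b _ => (monic_X_sub_C b).pow 2
  have hvdeg : v.natDegree = 2 * Fintype.card K := by
    rw [hvdef, natDegree_prod_X_sub_C_pow]; simp [mul_comm]
  have hle : ∑ b, (2 - affineCount A m₀ b) ≤ 2 * Fintype.card K := by
    calc ∑ b, (2 - affineCount A m₀ b) ≤ ∑ _b : K, 2 := Finset.sum_le_sum fun b _ => by omega
      _ = 2 * Fintype.card K := by simp [mul_comm]
  have key := sum_natDegree_sub_le (redeiPolynomial A) v hv A.card
    (2 * Fintype.card K - ∑ b, (2 - affineCount A m₀ b)) (∑ b, (2 - affineCount A m₀ b))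
    (by rw [hvdeg]; omega) (degree_coeff_redeiPolynomial_add_le A) f
    (fun m => monic_prod_of_monic _ _ fun b _ => (monic_X_sub_C b).pow _) ?_ m₀ (hfdeg m₀) ?_ Y
  · simpa only [hfdeg] using key
  · intro m
    rw [map_redeiPolynomial_eq_prod_pow, hvdef, hfdef, ← Finset.prod_mul_distrib]
    refine Finset.prod_dvd_prod_of_dvd _ _ fun b _ => ?_
    rw [← pow_add]
    exact pow_dvd_pow _ (by omega)
  · intro a ha
    refine Finset.prod_dvd_of_coprime
      (fun b _ c _ hbc => (pairwise_coprime_X_sub_C Function.injective_id hbc).pow) fun b _ => ?_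
    have hb : (X - C b) ^ 2 ∣ a * ∏ c : K, (X - C c) ^ affineCount A m₀ c := by
      rw [← map_redeiPolynomial_eq_prod_pow]
      exact (Finset.dvd_prod_of_mem (fun b : K => (X - C b) ^ 2) (Finset.mem_univ b)).trans ha
    rw [← Finset.mul_prod_erase _ _ (Finset.mem_univ b), ← mul_assoc] at hb
    have hprime : Prime (X - C b) := prime_X_sub_C b
    have hndvd : ¬ (X - C b) ∣ ∏ c ∈ Finset.univ.erase b, (X - C c) ^ affineCount A m₀ c := by
      rw [hprime.dvd_finsetProd_iff]
      rintro ⟨c, hc, hdvd⟩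
      have := hprime.dvd_of_dvd_pow hdvd
      rw [dvd_iff_isRoot, IsRoot, eval_sub, eval_X, eval_C, sub_eq_zero] at this
      exact (Finset.mem_erase.1 hc).1 this.symm
    have hb2 := hprime.pow_dvd_of_dvd_mul_right 2 hndvd hb
    rcases le_total 2 (affineCount A m₀ b) with h | h
    · rw [Nat.sub_eq_zero_of_le h, pow_zero]; exact one_dvd _
    · rw [show (X - C b) ^ 2 = (X - C b) ^ (2 - affineCount A m₀ b) *
        (X - C b) ^ affineCount A m₀ b by rw [← pow_add, Nat.sub_add_cancel h]] at hb2
      exact (mul_dvd_mul_iff_right (pow_ne_zero _ hprime.ne_zero)).1 hb2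

end Affine

/-! ### Deficiencies and indices in a projective plane -/

section Deficiency

open Configuration

open scoped Classical in
/-- The number of points of `S` on the line `l`. -/
noncomputable def secantCount {P L : Type*} [Membership P L] (S : Finset P) (l : L) : ℕ :=
  (S.filter fun p => p ∈ l).card

/-- The number of points by which `l` fails to be doubly blocked by `S`: two for a skew line, one
for a tangent and zero for every other line. -/
noncomputable def deficiency {P L : Type*} [Membership P L] (S : Finset P) (l : L) : ℕ :=
  2 - secantCount S l

/-- The sum of the deficiencies of all lines. -/
noncomputable def totalDeficiency {P : Type*} (L : Type*) [Membership P L] [Fintype L]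
    (S : Finset P) : ℕ :=
  ∑ l : L, deficiency S l

open scoped Classical in
/-- The index of a point: the sum of the deficiencies of the lines through it. -/
noncomputable def pointIndex {P : Type*} (L : Type*) [Membership P L] [Fintype L]
    (S : Finset P) (p : P) : ℕ :=
  ∑ l : L with p ∈ l, deficiency S l

variable {P L : Type*} [Membership P L] [Fintype L] {S : Finset P}

lemma deficiency_le_index {p : P} {l : L} (hp : p ∈ l) : deficiency S l ≤ pointIndex L S p := by
  classical
  exact Finset.single_le_sum (f := fun l : L => deficiency S l) (fun _ _ => Nat.zero_le _)
    (by simpa using hp)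

/-- Two distinct lines through a point contribute their deficiencies independently. -/
lemma deficiency_add_deficiency_le_index {p : P} {l m : L} (hlm : l ≠ m) (hl : p ∈ l)
    (hm : p ∈ m) : deficiency S l + deficiency S m ≤ pointIndex L S p := by
  classical
  rw [← Finset.sum_pair (f := fun l : L => deficiency S l) hlm]
  exact Finset.sum_le_sum_of_subset fun x hx => by
    rcases Finset.mem_insert.1 hx with rfl | hx
    · simpa using hl
    · rw [Finset.mem_singleton.1 hx]; simpa using hm

/-- When each point of `S` is on at most one tangent, the tangents contribute at most `|S|` to the
total deficiency. -/
lemma totalDeficiency_le_add_skew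
    (htan : ∀ p ∈ S, ∀ l m : L, p ∈ l → p ∈ m → secantCount S l = 1 → secantCount S m = 1 → l = m) :
    totalDeficiency L S ≤
      S.card + 2 * (Finset.univ.filter fun l : L => secantCount S l = 0).card := by
  classical
  have h1 : (Finset.univ.filter fun l : L => secantCount S l = 1).card ≤ S.card := by
    have : ∀ l : L, secantCount S l = 1 → ∃ p ∈ S, p ∈ l := fun l hl => by
      obtain ⟨p, hp⟩ := Finset.card_pos.1 (by rw [secantCount] at hl; omega :
        0 < (S.filter fun p => p ∈ l).card)
      exact ⟨p, Finset.mem_filter.1 hp⟩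
    refine Finset.card_le_card_of_forall_subsingleton (fun l p => p ∈ l)
      (fun l hl => this l (by simpa using hl)) ?_
    rintro p hp l ⟨hl, hpl⟩ m ⟨hm, hpm⟩
    exact htan p hp l m hpl hpm (by simpa using hl) (by simpa using hm)
  have h2 : totalDeficiency L S = (Finset.univ.filter fun l : L => secantCount S l = 1).card +
      2 * (Finset.univ.filter fun l : L => secantCount S l = 0).card := by
    rw [totalDeficiency, Finset.card_filter, Finset.card_filter, Finset.mul_sum,
      ← Finset.sum_add_distrib]
    refine Finset.sum_congr rfl fun l _ => ?_
    rw [deficiency]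
    split_ifs <;> omega
  omega

lemma totalDeficiency_le_card_add_two
    (hskew : ∀ l m : L, secantCount S l = 0 → secantCount S m = 0 → l = m)
    (htan : ∀ p ∈ S, ∀ l m : L, p ∈ l → p ∈ m → secantCount S l = 1 → secantCount S m = 1 → l = m) :
    totalDeficiency L S ≤ S.card + 2 := by
  have h := totalDeficiency_le_add_skew htan
  have h1 : (Finset.univ.filter fun l : L => secantCount S l = 0).card ≤ 1 :=
    Finset.card_le_one.2 fun l hl m hm => hskew l m (by simpa using hl) (by simpa using hm)
  omega

/-- A point of `S` on a tangent has index one, since no other tangent passes through it. -/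
lemma index_eq_one_of_mem
    (htan : ∀ p ∈ S, ∀ l m : L, p ∈ l → p ∈ m → secantCount S l = 1 → secantCount S m = 1 → l = m)
    {p : P} (hp : p ∈ S) {t : L} (hpt : p ∈ t) (ht : secantCount S t = 1) :
    pointIndex L S p = 1 := by
  classical
  rw [pointIndex, Finset.sum_eq_single_of_mem t (by simpa using hpt), deficiency, ht]
  intro m hm hne
  have hpm : p ∈ m := by simpa using hm
  have h0 : 0 < secantCount S m := Finset.card_pos.2 ⟨p, Finset.mem_filter.2 ⟨hp, hpm⟩⟩
  have h1 : secantCount S m ≠ 1 := fun h => hne (htan p hp m t hpm hpt h ht)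
  rw [deficiency]
  omega

variable [ProjectivePlane P L]

/-- Three points together count each line once, apart from the lines joining two of them. -/
lemma index_add_index_add_index_le {a b c : P} (hab : a ≠ b) (hac : a ≠ c) (hbc : b ≠ c) :
    pointIndex L S a + pointIndex L S b + pointIndex L S c ≤ totalDeficiency L S + 6 := by
  classical
  obtain ⟨l₁, -, h₁⟩ := HasLines.existsUnique_line P L a b hab
  obtain ⟨l₂, -, h₂⟩ := HasLines.existsUnique_line P L a c hac
  obtain ⟨l₃, -, h₃⟩ := HasLines.existsUnique_line P L b c hbc
  have hle : ∀ l : L, deficiency S l ≤ 2 := fun l => Nat.sub_le _ _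
  have hsum : pointIndex L S a + pointIndex L S b + pointIndex L S c ≤ totalDeficiency L S +
      (deficiency S l₁ + deficiency S l₂ + deficiency S l₃) := by
    simp only [pointIndex, totalDeficiency, Finset.sum_filter]
    have hite : ∀ m : L, deficiency S m = ∑ l : L, if l = m then deficiency S l else 0 :=
      fun m => by rw [Finset.sum_ite_eq' Finset.univ m, if_pos (Finset.mem_univ m)]
    rw [hite l₁, hite l₂, hite l₃]
    simp only [← Finset.sum_add_distrib]
    refine Finset.sum_le_sum fun l _ => ?_
    have key : ∀ {x y : P} {m : L}, (∀ k : L, x ∈ k ∧ y ∈ k → k = m) → x ∈ l → y ∈ l →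
        deficiency S l ≤ if l = m then deficiency S l else 0 := fun h hx hy => by
      rw [if_pos (h l ⟨hx, hy⟩)]
    have k₁ := key h₁
    have k₂ := key h₂
    have k₃ := key h₃
    by_cases ha : a ∈ l <;> by_cases hb : b ∈ l <;> by_cases hc : c ∈ l <;>
      simp only [ha, hb, hc, if_true, if_false, true_implies, false_implies] at k₁ k₂ k₃ ⊢ <;>
      omega
  have := hle l₁
  have := hle l₂
  have := hle l₃
  omega

variable [Fintype P]

open scoped Classical in
lemma card_points_on (l : L) : (Finset.univ.filter fun p : P => p ∈ l).card =
    ProjectivePlane.order P L + 1 := by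
  rw [← ProjectivePlane.pointCount_eq P l, pointCount, Nat.card_eq_fintype_card,
    Fintype.card_subtype]

open scoped Classical in
lemma card_lines_through (p : P) : (Finset.univ.filter fun l : L => p ∈ l).card =
    ProjectivePlane.order P L + 1 := by
  rw [← ProjectivePlane.lineCount_eq (L := L) p, lineCount, Nat.card_eq_fintype_card,
    Fintype.card_subtype]

open scoped Classical in
lemma card_inter_lines (l m : L) : (Finset.univ.filter fun p : P => p ∈ l ∧ p ∈ m).card =
    1 + if m = l then ProjectivePlane.order P L else 0 := by
  split_ifs with h
  · subst h
    simp only [and_self, card_points_on]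
    omega
  · obtain ⟨p, hp, hu⟩ := HasPoints.existsUnique_point P L l m (Ne.symm h)
    rw [add_zero, Finset.card_eq_one]
    exact ⟨p, by ext x; simpa using ⟨fun hx => hu x hx, fun hx => hx ▸ hp⟩⟩

variable (S) in
open scoped Classical in
lemma sum_index_on_line (l : L) : ∑ p : P with p ∈ l, pointIndex L S p =
    totalDeficiency L S + ProjectivePlane.order P L * deficiency S l := by
  simp only [pointIndex, Finset.sum_filter]
  have h1 : ∀ p : P, (if p ∈ l then ∑ m : L, if p ∈ m then deficiency S m else 0 else 0) =
      ∑ m : L, if p ∈ l ∧ p ∈ m then deficiency S m else 0 := fun p => by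
    by_cases h : p ∈ l <;> simp [h]
  rw [Finset.sum_congr rfl fun p _ => h1 p, Finset.sum_comm]
  have h2 : ∀ m : L, (∑ p : P, if p ∈ l ∧ p ∈ m then deficiency S m else 0) =
      deficiency S m + if m = l then ProjectivePlane.order P L * deficiency S l else 0 :=
    fun m => by
    rw [← Finset.sum_filter, Finset.sum_const, card_inter_lines, smul_eq_mul, add_mul, one_mul]
    split_ifs with h
    · rw [h]
    · rw [zero_mul]
  rw [Finset.sum_congr rfl fun m _ => h2 m, Finset.sum_add_distrib, Finset.sum_ite_eq']
  simp [totalDeficiency]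

variable (S) in
lemma sum_secantCount : ∑ l : L, secantCount S l =
    S.card * (ProjectivePlane.order P L + 1) := by
  classical
  simp only [secantCount, Finset.card_filter]
  rw [Finset.sum_comm]
  simp only [← Finset.card_filter, card_lines_through, Finset.sum_const, smul_eq_mul]

/-- Through each point outside `S` there is a line with at least two points of `S`: otherwise
`S` would have at most `q + 1` points, too few for so small a total deficiency. -/
lemma exists_two_le_secantCount (hq : 3 ≤ ProjectivePlane.order P L)
    (hT : totalDeficiency L S ≤ S.card + 2) {p : P} (hp : p ∉ S) :
    ∃ l : L, p ∈ l ∧ 2 ≤ secantCount S l := by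
  classical
  by_contra! hcon
  have h1 : S.card = ∑ l : L with p ∈ l, secantCount S l := by
    simp only [secantCount, Finset.card_filter]
    rw [Finset.sum_comm, Finset.card_eq_sum_ones]
    refine Finset.sum_congr rfl fun x hx => ?_
    have hxp : p ≠ x := fun h => hp (h ▸ hx)
    obtain ⟨l, ⟨hl1, hl2⟩, hu⟩ := HasLines.existsUnique_line P L p x hxp
    rw [Finset.sum_eq_single_of_mem l (by simpa using hl1), if_pos hl2]
    intro m hm hne
    exact if_neg fun hxm => hne (hu m ⟨by simpa using hm, hxm⟩)
  have h2 : S.card ≤ ProjectivePlane.order P L + 1 := by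
    rw [h1, ← card_lines_through (L := L) p, Finset.card_eq_sum_ones]
    exact Finset.sum_le_sum fun l hl => Nat.le_of_lt_succ (hcon l (by simpa using hl))
  have h3 : 2 * Fintype.card L ≤
      S.card * (ProjectivePlane.order P L + 1) + totalDeficiency L S := by
    rw [← sum_secantCount (L := L) S, totalDeficiency, ← Finset.sum_add_distrib, mul_comm,
      ← smul_eq_mul, ← Finset.card_univ, ← Finset.sum_const]
    exact Finset.sum_le_sum fun l _ => by rw [deficiency]; omega
  rw [ProjectivePlane.card_lines P L] at h3
  nlinarith

/-- Each tangent passes through a point of large index outside `S`: otherwise the total deficiency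
would be so small that the quadratic inequality excludes even the indices one and two. -/
lemma exists_three_le_index_of_tangent
    (hcard : 4 * S.card + 12 < 9 * ProjectivePlane.order P L)
    (htan : ∀ p ∈ S, ∀ l m : L, p ∈ l → p ∈ m → secantCount S l = 1 → secantCount S m = 1 → l = m)
    (hquad : ∀ p ∉ S, (pointIndex L S p : ℤ) *
      (3 * ProjectivePlane.order P L + 1 - S.card - pointIndex L S p) ≤ totalDeficiency L S)
    {t : L} (ht : secantCount S t = 1) : ∃ p ∉ S, p ∈ t ∧ 3 ≤ pointIndex L S p := by
  classical
  by_contra! hcon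
  obtain ⟨p₀, hp₀⟩ := Finset.card_eq_one.1 ht
  have hp₀' : p₀ ∈ S.filter fun p => p ∈ t := by rw [hp₀]; exact Finset.mem_singleton_self _
  obtain ⟨hp₀S, hp₀t⟩ := Finset.mem_filter.1 hp₀'
  set F : Finset P := (Finset.univ.filter fun p => p ∈ t).erase p₀ with hF
  have hFcard : F.card = ProjectivePlane.order P L := by
    rw [hF, Finset.card_erase_of_mem (by simpa using hp₀t), card_points_on, Nat.add_sub_cancel]
  have hFmem : ∀ p ∈ F, p ∉ S ∧ p ∈ t := fun p hp => by
    have hpt : p ∈ t := by simpa using Finset.mem_of_mem_erase hp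
    refine ⟨fun hpS => (Finset.mem_erase.1 hp).1 ?_, hpt⟩
    have : p ∈ S.filter fun p => p ∈ t := Finset.mem_filter.2 ⟨hpS, hpt⟩
    rwa [hp₀, Finset.mem_singleton] at this
  have hdef : deficiency S t = 1 := by rw [deficiency, ht]
  have hsum : 1 + ∑ p ∈ F, pointIndex L S p = totalDeficiency L S + ProjectivePlane.order P L := by
    have := sum_index_on_line S t
    rw [hdef, mul_one, ← Finset.add_sum_erase _ _ (by simpa using hp₀t),
      index_eq_one_of_mem htan hp₀S hp₀t ht] at this
    exact this
  have hle : ∀ b : ℕ, (∀ p ∈ F, pointIndex L S p ≤ b) →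
      totalDeficiency L S + ProjectivePlane.order P L ≤ 1 + ProjectivePlane.order P L * b :=
    fun b hb => by
      rw [← hsum, ← hFcard, ← smul_eq_mul]
      gcongr
      exact Finset.sum_le_card_nsmul _ _ _ hb
  have h2 : ∀ p ∈ F, pointIndex L S p ≤ 2 := fun p hp =>
    Nat.le_of_lt_succ (hcon p (hFmem p hp).1 (hFmem p hp).2)
  have hT2 := hle 2 h2
  have h1 : ∀ p ∈ F, pointIndex L S p ≤ 1 := fun p hp => by
    by_contra! h
    have hq := hquad p (hFmem p hp).1
    rw [show pointIndex L S p = 2 from le_antisymm (h2 p hp) h] at hq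
    push_cast at hq
    omega
  have hT1 := hle 1 h1
  obtain ⟨p, hp⟩ : F.Nonempty := Finset.card_pos.1 (by omega)
  have hq := hquad p (hFmem p hp).1
  have hpos : deficiency S t ≤ pointIndex L S p := deficiency_le_index (hFmem p hp).2
  rw [show pointIndex L S p = 1 from le_antisymm (h1 p hp) (hdef ▸ hpos)] at hq
  push_cast at hq
  omega

/-- The combinatorial half of the argument, valid in every projective plane of order `q`: if
the index `k` of each point outside `S` satisfies `k * (3 * q + 1 - |S| - k) ≤ T`, where `T` is
the total deficiency, then two further points suffice for a double blocking set. -/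
theorem exists_doubly_blocking_extension
    (hcard : 4 * S.card + 12 < 9 * ProjectivePlane.order P L)
    (hskew : ∀ l m : L, secantCount S l = 0 → secantCount S m = 0 → l = m)
    (htan : ∀ p ∈ S, ∀ l m : L, p ∈ l → p ∈ m → secantCount S l = 1 → secantCount S m = 1 → l = m)
    (hquad : ∀ p ∉ S, (pointIndex L S p : ℤ) *
      (3 * ProjectivePlane.order P L + 1 - S.card - pointIndex L S p) ≤ totalDeficiency L S) :
    ∃ T : Finset P, T.card ≤ 2 ∧ ∀ l : L, 
      ∃ U : Finset P, 2 ≤ U.card ∧ ∀ p ∈ U, (p ∈ S ∨ p ∈ T) ∧ p ∈ l := by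
  classical
  have hT := totalDeficiency_le_card_add_two hskew htan
  set B : Finset P := Finset.univ.filter fun p => p ∉ S ∧ 3 ≤ pointIndex L S p with hB
  -- the quadratic inequality leaves a gap between the indices `2` and `3 * q - 1 - |S|`
  have hbig : ∀ p ∈ B, 3 * (ProjectivePlane.order P L : ℤ) - 1 - S.card ≤ pointIndex L S p := by
    intro p hp
    obtain ⟨hpS, hp3⟩ := (Finset.mem_filter.1 hp).2
    have hq := hquad p hpS
    by_contra! hlt
    have h1 : (0 : ℤ) ≤ pointIndex L S p - 3 := by omega
    have h2 : (0 : ℤ) ≤ 3 * (ProjectivePlane.order P L : ℤ) - 2 - S.card - pointIndex L S p := by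
      omega
    have := mul_nonneg h1 h2
    have h3 : (totalDeficiency L S : ℤ) ≤ S.card + 2 := by exact_mod_cast hT
    have h4 : 4 * (S.card : ℤ) + 12 < 9 * ProjectivePlane.order P L := by exact_mod_cast hcard
    linarith
  have hBcard : B.card ≤ 2 := by
    by_contra! h
    obtain ⟨a, ha, b, hb, c, hc, hab, hac, hbc⟩ := Finset.two_lt_card.1 h
    have := index_add_index_add_index_le (L := L) (S := S) hab hac hbc
    have := hbig a ha
    have := hbig b hb
    have := hbig c hc
    omega
  have hline : ∀ (T : Finset P) (l : L), (secantCount S l = 1 → ∃ p ∈ T, p ∉ S ∧ p ∈ l) →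
      secantCount S l ≠ 0 → ∃ U : Finset P, 2 ≤ U.card ∧ ∀ p ∈ U, (p ∈ S ∨ p ∈ T) ∧ p ∈ l := by
    intro T l h1 h0
    by_cases h : secantCount S l = 1
    · obtain ⟨p, hpT, hpS, hpl⟩ := h1 h
      refine ⟨insert p (S.filter fun p => p ∈ l), ?_, fun x hx => ?_⟩
      · rw [Finset.card_insert_of_notMem (by simp [hpS])]
        exact Nat.succ_le_succ h.ge
      · rcases Finset.mem_insert.1 hx with rfl | hx
        · exact ⟨Or.inr hpT, hpl⟩
        · exact ⟨Or.inl (Finset.mem_filter.1 hx).1, (Finset.mem_filter.1 hx).2⟩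
    · exact ⟨S.filter fun p => p ∈ l, by change 2 ≤ secantCount S l; omega,
        fun x hx => ⟨Or.inl (Finset.mem_filter.1 hx).1, (Finset.mem_filter.1 hx).2⟩⟩
  by_cases hs : ∃ s : L, secantCount S s = 0
  · -- every tangent meets the skew line `s` in a point of index at least `2 + 1`
    obtain ⟨s, hs⟩ := hs
    obtain ⟨T, hBT, hTs, hT2⟩ := Finset.exists_subsuperset_card_eq (n := 2)
      (s := B.filter fun p => p ∈ s) (t := Finset.univ.filter fun p => p ∈ s)
      (Finset.filter_subset_filter _ (Finset.subset_univ _))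
      ((Finset.card_filter_le _ _).trans hBcard) (by rw [card_points_on]; omega)
    refine ⟨T, hT2.le, fun l => ?_⟩
    by_cases hls : l = s
    · exact ⟨T, hT2.ge, fun p hp => ⟨Or.inr hp, by rw [hls]; simpa using hTs hp⟩⟩
    refine hline T l (fun hl => ?_) fun h0 => hls (hskew l s h0 hs)
    obtain ⟨p, ⟨hpl, hps⟩, -⟩ := HasPoints.existsUnique_point P L l s hls
    have hpS : p ∉ S := fun hpS =>
      Finset.notMem_empty p (Finset.card_eq_zero.1 hs ▸ Finset.mem_filter.2 ⟨hpS, hps⟩)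
    have h3 := deficiency_add_deficiency_le_index (S := S) hls hpl hps
    rw [deficiency, deficiency, hl, hs] at h3
    refine ⟨p, hBT ?_, hpS, hpl⟩
    simp only [hB, Finset.mem_filter, Finset.mem_univ, hpS, hps]
    simpa using h3
  · push Not at hs
    refine ⟨B, hBcard, fun l => hline B l (fun hl => ?_) (hs l)⟩
    obtain ⟨p, hpS, hpl, hp3⟩ := exists_three_le_index_of_tangent hcard htan hquad hl
    exact ⟨p, by simp [hB, hpS, hp3], hpS, hpl⟩

end Deficiency

/-! ### Affine charts and the quadratic inequality -/

section Chart

open Configuration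

/-- Affine coordinates on the complement of a line `lineInf` of a projective plane, relative to a
point `ptInf` of that line.  The points `dir m` are the other points of `lineInf`, the points
`pt (x, y)` those off `lineInf`, and `line m b` is the line `y = m * x + b`, of direction `m`. -/
structure AffineChart (K P L : Type*) [Field K] [Membership P L] where
  lineInf : L
  ptInf : P
  dir : K → P
  pt : K × K → P
  line : K → K → L
  mem_lineInf_iff : ∀ x, x ∈ lineInf ↔ x = ptInf ∨ ∃ m, dir m = x
  dir_ne : ∀ m, dir m ≠ ptInf
  dir_injective : Function.Injective dir
  notMem_lineInf_iff : ∀ x, x ∉ lineInf ↔ ∃ z, pt z = x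
  pt_injective : Function.Injective pt
  dir_mem_iff : ∀ m l, dir m ∈ l ↔ l = lineInf ∨ ∃ b, line m b = l
  pt_mem_line_iff : ∀ m b z, pt z ∈ line m b ↔ z.2 = m * z.1 + b

namespace AffineChart

variable {K P L : Type*} [Field K] [Membership P L]

lemma line_ne_lineInf (c : AffineChart K P L) (m b : K) : c.line m b ≠ c.lineInf := fun h =>
  (c.notMem_lineInf_iff (c.pt (0, b))).2 ⟨_, rfl⟩ (h ▸ (c.pt_mem_line_iff m b (0, b)).2 (by simp))

lemma line_injective (c : AffineChart K P L) (m : K) : Function.Injective (c.line m) := by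
  intro b b' h
  have h1 : c.pt (0, b) ∈ c.line m b' := h ▸ (c.pt_mem_line_iff m b (0, b)).2 (by simp)
  simpa using (c.pt_mem_line_iff m b' (0, b)).1 h1

variable [Fintype K] (c : AffineChart K P L)

open scoped Classical in
lemma filter_mem_lineInf [Fintype P] :
    (Finset.univ.filter fun x : P => x ∈ c.lineInf) =
      insert c.ptInf (Finset.univ.image c.dir) := by
  ext x
  simp [c.mem_lineInf_iff]

lemma ptInf_notMem_image [DecidableEq P] : c.ptInf ∉ Finset.univ.image c.dir := by
  simpa using c.dir_ne

open scoped Classical in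
/-- The coordinates of the points of `S` off the line at infinity. -/
noncomputable def affinePart (S : Finset P) : Finset (K × K) :=
  Finset.univ.filter fun z => c.pt z ∈ S

lemma card_affinePart_add (S : Finset P) :
    (c.affinePart S).card + secantCount S c.lineInf = S.card := by
  classical
  have h : (c.affinePart S).card = (S.filter fun x => ¬ x ∈ c.lineInf).card := by
    rw [← Finset.card_image_of_injective _ c.pt_injective]
    refine congrArg _ ?_
    ext x
    simp only [affinePart, Finset.mem_image, Finset.mem_filter, Finset.mem_univ, true_and,
      c.notMem_lineInf_iff]
    exact ⟨fun ⟨z, hz, hx⟩ => ⟨hx ▸ hz, z, hx⟩, fun ⟨hx, z, hz⟩ => ⟨z, hz ▸ hx, hz⟩⟩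
  rw [h, secantCount, add_comm, Finset.card_filter_add_card_filter_not]

lemma secantCount_line [ProjectivePlane P L] [DecidableEq K] {S : Finset P} {m : K}
    (hm : c.dir m ∉ S) (b : K) :
    secantCount S (c.line m b) = affineCount (c.affinePart S) m b := by
  classical
  rw [affineCount, ← Finset.card_image_of_injective _ c.pt_injective, secantCount]
  refine congrArg _ ?_
  ext x
  simp only [affinePart, Finset.mem_image, Finset.mem_filter, Finset.mem_univ, true_and,
    ← c.pt_mem_line_iff]
  refine ⟨fun ⟨hxS, hx⟩ => ?_, ?_⟩
  · have hxi : x ∉ c.lineInf := fun hxi => by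
      obtain ⟨y, -, hy⟩ := HasPoints.existsUnique_point P L _ _ (c.line_ne_lineInf m b)
      have h1 := hy x ⟨hx, hxi⟩
      have h2 := hy (c.dir m) ⟨(c.dir_mem_iff m _).2 (Or.inr ⟨b, rfl⟩),
        (c.dir_mem_iff m _).2 (Or.inl rfl)⟩
      exact hm (h2 ▸ h1 ▸ hxS)
    obtain ⟨z, rfl⟩ := (c.notMem_lineInf_iff x).1 hxi
    exact ⟨z, ⟨hxS, hx⟩, rfl⟩
  · rintro ⟨z, ⟨hzS, hz⟩, rfl⟩
    exact ⟨hzS, hz⟩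

lemma index_dir [Fintype L] [ProjectivePlane P L] [DecidableEq K] {S : Finset P}
    (hinf : deficiency S c.lineInf = 0) {m : K} (hm : c.dir m ∉ S) :
    pointIndex L S (c.dir m) = ∑ b, (2 - affineCount (c.affinePart S) m b) := by
  classical
  have h : (Finset.univ.filter fun l : L => c.dir m ∈ l) =
      insert c.lineInf (Finset.univ.image (c.line m)) := by
    ext l
    simp [c.dir_mem_iff]
  rw [pointIndex, h, Finset.sum_insert (by simpa using c.line_ne_lineInf m), hinf, zero_add,
    Finset.sum_image fun b _ b' _ hb => c.line_injective m hb]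
  exact Finset.sum_congr rfl fun b _ => by rw [deficiency, c.secantCount_line hm]

variable [Fintype P] [Fintype L] [ProjectivePlane P L]

lemma order_eq_card (c : AffineChart K P L) : ProjectivePlane.order P L = Fintype.card K := by
  classical
  have h := card_points_on (P := P) c.lineInf
  rw [filter_mem_lineInf, Finset.card_insert_of_notMem c.ptInf_notMem_image,
    Finset.card_image_of_injective _ c.dir_injective, Finset.card_univ] at h
  omega

/-- The quadratic inequality for the index of a point outside `S`, read off in affine coordinates
in which the point is at infinity. -/
theorem index_mul_le {S : Finset P} (hmem : c.ptInf ∈ S)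
    (hinf : deficiency S c.lineInf = 0) {m₀ : K} (hm₀ : c.dir m₀ ∉ S) :
    (pointIndex L S (c.dir m₀) : ℤ) *
      (3 * ProjectivePlane.order P L + 1 - S.card - pointIndex L S (c.dir m₀)) ≤
        totalDeficiency L S := by
  classical
  set Y : Finset K := Finset.univ.filter fun m => c.dir m ∉ S with hY
  set k := pointIndex L S (c.dir m₀) with hk
  have hkey := sum_deficiency_sub_le (c.affinePart S) m₀ Y
  rw [← c.index_dir hinf hm₀, ← c.order_eq_card, ← hk,
    Finset.sum_congr rfl fun m hm => by
      rw [← c.index_dir hinf (Finset.mem_filter.1 hm).2]] at hkey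
  -- `ptInf` is a point of `S` on `lineInf` that is not one of the directions
  have hYcard : Y.card + secantCount S c.lineInf = ProjectivePlane.order P L + 1 := by
    have h1 : secantCount S c.lineInf = (Finset.univ.filter fun m => c.dir m ∈ S).card + 1 := by
      rw [← Finset.card_image_of_injective _ c.dir_injective,
        ← Finset.card_insert_of_notMem (a := c.ptInf) (by
          simpa using fun m _ => c.dir_ne m), secantCount]
      refine congrArg _ ?_
      ext x
      simp only [Finset.mem_filter, c.mem_lineInf_iff, Finset.mem_insert, Finset.mem_image,
        Finset.mem_univ, true_and]
      constructor
      · rintro ⟨hx, rfl | ⟨m, rfl⟩⟩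
        · exact Or.inl rfl
        · exact Or.inr ⟨m, hx, rfl⟩
      · rintro (rfl | ⟨m, hx, rfl⟩)
        · exact ⟨hmem, Or.inl rfl⟩
        · exact ⟨hx, Or.inr ⟨m, rfl⟩⟩
    have h2 := Finset.card_filter_add_card_filter_not (s := (Finset.univ : Finset K))
      (fun m => c.dir m ∈ S)
    rw [Finset.card_univ, ← c.order_eq_card, ← hY] at h2
    rw [h1]
    omega
  have hsum : ∑ m ∈ Y, pointIndex L S (c.dir m) ≤ totalDeficiency L S := by
    have h := sum_index_on_line S c.lineInf
    rw [hinf, mul_zero, add_zero, c.filter_mem_lineInf,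
      Finset.sum_insert c.ptInf_notMem_image,
      Finset.sum_image fun m _ m' _ h => c.dir_injective h] at h
    rw [← h]
    exact (Finset.sum_le_sum_of_subset (Finset.subset_univ Y)).trans (Nat.le_add_left _ _)
  have hsub : (Y.card : ℤ) * k - totalDeficiency L S ≤
      ((∑ m ∈ Y, (k - pointIndex L S (c.dir m)) : ℕ) : ℤ) := by
    have h1 : Y.card * k ≤
        ∑ m ∈ Y, (k - pointIndex L S (c.dir m)) + ∑ m ∈ Y, pointIndex L S (c.dir m) := by
      rw [← Finset.sum_add_distrib, ← smul_eq_mul, ← Finset.sum_const]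
      exact Finset.sum_le_sum fun m _ => by omega
    have h2 : ((Y.card * k : ℕ) : ℤ) ≤
        ((∑ m ∈ Y, (k - pointIndex L S (c.dir m)) + totalDeficiency L S : ℕ) : ℤ) := by
      exact_mod_cast h1.trans (Nat.add_le_add_left hsum _)
    rw [Nat.cast_mul, Nat.cast_add] at h2
    linarith
  have h3 : (2 * (ProjectivePlane.order P L : ℤ) - k) ≤
      ((2 * ProjectivePlane.order P L - k : ℕ) : ℤ) := by omega
  have h4 := mul_le_mul_of_nonneg_left h3 (Int.natCast_nonneg k)
  have h5 : ((∑ m ∈ Y, (k - pointIndex L S (c.dir m)) : ℕ) : ℤ) +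
      (k : ℤ) * ((2 * ProjectivePlane.order P L - k : ℕ) : ℤ) ≤
      (k : ℤ) * ((c.affinePart S).card : ℤ) := by exact_mod_cast hkey
  have h6 : ((c.affinePart S).card : ℤ) = S.card - secantCount S c.lineInf := by
    rw [← c.card_affinePart_add S]; push_cast; ring
  have h7 : (Y.card : ℤ) = ProjectivePlane.order P L + 1 - secantCount S c.lineInf := by
    rw [eq_sub_iff_add_eq]; exact_mod_cast hYcard
  rw [h7] at hsub
  rw [h6] at h5
  linarith

end AffineChart

end Chart

/-! ### Charts of the Desarguesian plane -/

section Desarguesian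

open Configuration Configuration.ofField
open scoped LinearAlgebra.Projectivization

variable {K : Type*} [Field K]

/-- Two independent vectors are part of a basis `B` of `K ^ 3` with a dual basis `W` for the dot
product. -/
lemma exists_dual_bases {e p : Fin 3 → K} (h : crossProduct e p ≠ 0) :
    ∃ B W : Fin 3 → Fin 3 → K, B 0 = e ∧ B 1 = p ∧
      (∀ i j, B i ⬝ᵥ W j = if i = j then 1 else 0) ∧
      (∀ z, z = ∑ i, (z ⬝ᵥ W i) • B i) ∧ ∀ w, w = ∑ i, (B i ⬝ᵥ w) • W i := by
  obtain ⟨i, hi⟩ := Function.ne_iff.1 h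
  let M : Matrix (Fin 3) (Fin 3) K := Matrix.of ![e, p, Pi.single i 1]
  have hdet : M.det ≠ 0 := by
    have : M.det = crossProduct e p i := by
      rw [← single_one_dotProduct i (crossProduct e p), ← triple_product_permutation,
        ← triple_product_permutation, triple_product_eq_det]
      rfl
    rw [this]
    exact hi
  have h1 : M * M⁻¹ = 1 := Matrix.mul_nonsing_inv _ (isUnit_iff_ne_zero.2 hdet)
  have h2 : M⁻¹ * M = 1 := Matrix.nonsing_inv_mul _ (isUnit_iff_ne_zero.2 hdet)
  refine ⟨M, (M⁻¹).transpose, rfl, rfl, fun i j => ?_, fun z => ?_, fun w => ?_⟩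
  · have := congrFun (congrFun h1 i) j
    rwa [Matrix.mul_apply, Matrix.one_apply] at this
  · have := Matrix.vecMul_vecMul z M⁻¹ M
    rw [h2, Matrix.vecMul_one] at this
    conv_lhs => rw [← this]
    rw [Matrix.vecMul_eq_sum]
    rfl
  · have := Matrix.mulVec_mulVec w M⁻¹ M
    rw [h2, Matrix.one_mulVec] at this
    conv_lhs => rw [← this]
    rw [Matrix.mulVec_eq_sum]
    refine Finset.sum_congr rfl fun i _ => ?_
    rw [op_smul_eq_smul]
    rfl

/-- Any two distinct points of the plane are the point at infinity and the direction `0` of some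
affine chart. -/
lemma exists_affineChart {P Q : ProjPlane.PGPoint K} (hPQ : P ≠ Q) :
    ∃ c : AffineChart K (ProjPlane.PGPoint K) (ProjPlane.PGLine K), c.ptInf = Q ∧ c.dir 0 = P := by
  induction P using Projectivization.ind with | h p hp =>
  induction Q using Projectivization.ind with | h e he =>
  have hcross : crossProduct e p ≠ 0 := fun h =>
    hPQ ((Projectivization.mk_eq_mk_iff_crossProduct_eq_zero he hp).2 h).symm
  obtain ⟨B, W, rfl, rfl, hBW, hB, hW⟩ := exists_dual_bases hcross
  have hdir : ∀ m : K, B 1 + m • B 0 ≠ 0 := fun m h => by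
    simpa [add_dotProduct, smul_dotProduct, hBW] using congrArg (· ⬝ᵥ W 1) h
  have hpt : ∀ z : K × K, B 2 + z.1 • B 1 + z.2 • B 0 ≠ 0 := fun z h => by
    simpa [add_dotProduct, smul_dotProduct, hBW] using congrArg (· ⬝ᵥ W 2) h
  have hline : ∀ m b : K, W 0 - m • W 1 - b • W 2 ≠ 0 := fun m b h => by
    simpa [dotProduct_sub, dotProduct_smul, hBW] using congrArg (B 0 ⬝ᵥ ·) h
  have hinf : W 2 ≠ 0 := fun h => by
    simpa [hBW] using congrArg (B 2 ⬝ᵥ ·) h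
  simp only [Fin.sum_univ_three] at hB hW
  refine ⟨{
    lineInf := Projectivization.mk K (W 2) hinf
    ptInf := Projectivization.mk K (B 0) he
    dir := fun m => Projectivization.mk K _ (hdir m)
    pt := fun z => Projectivization.mk K _ (hpt z)
    line := fun m b => Projectivization.mk K _ (hline m b)
    mem_lineInf_iff := ?_
    dir_ne := ?_
    dir_injective := ?_
    notMem_lineInf_iff := ?_
    pt_injective := ?_
    dir_mem_iff := ?_
    pt_mem_line_iff := ?_ }, rfl, ?_⟩
  · intro x
    constructor
    · intro hx
      induction x using Projectivization.ind with | h v hv =>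
      have hv2 : v ⬝ᵥ W 2 = 0 := hx
      have hvB := hB v
      rw [hv2, zero_smul, add_zero] at hvB
      by_cases h1 : v ⬝ᵥ W 1 = 0
      · rw [h1, zero_smul, add_zero] at hvB
        exact Or.inl ((Projectivization.mk_eq_mk_iff' ..).2 ⟨_, hvB.symm⟩)
      · refine Or.inr ⟨(v ⬝ᵥ W 0) / (v ⬝ᵥ W 1),
          ((Projectivization.mk_eq_mk_iff' ..).2 ⟨v ⬝ᵥ W 1, ?_⟩).symm⟩
        rw [smul_add, smul_smul, mul_div_cancel₀ _ h1, add_comm]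
        exact hvB.symm
    · rintro (rfl | ⟨m, rfl⟩)
      · change B 0 ⬝ᵥ W 2 = 0
        simp [hBW]
      · change (B 1 + m • B 0) ⬝ᵥ W 2 = 0
        simp [add_dotProduct, smul_dotProduct, hBW]
  · intro m h
    obtain ⟨a, ha⟩ := (Projectivization.mk_eq_mk_iff' ..).1 h
    simpa [add_dotProduct, smul_dotProduct, hBW] using congrArg (· ⬝ᵥ W 1) ha
  · intro m m' h
    obtain ⟨a, ha⟩ := (Projectivization.mk_eq_mk_iff' ..).1 h
    have h1 : a = 1 := by
      simpa [add_dotProduct, smul_dotProduct, hBW] using congrArg (· ⬝ᵥ W 1) ha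
    have h0 : a * m' = m := by
      simpa [add_dotProduct, smul_dotProduct, hBW] using congrArg (· ⬝ᵥ W 0) ha
    rw [← h0, h1, one_mul]
  · intro x
    constructor
    · intro hx
      induction x using Projectivization.ind with | h v hv =>
      have hv2 : v ⬝ᵥ W 2 ≠ 0 := hx
      refine ⟨((v ⬝ᵥ W 1) / (v ⬝ᵥ W 2), (v ⬝ᵥ W 0) / (v ⬝ᵥ W 2)),
        ((Projectivization.mk_eq_mk_iff' ..).2 ⟨v ⬝ᵥ W 2, ?_⟩).symm⟩
      rw [smul_add, smul_add, smul_smul, smul_smul, mul_div_cancel₀ _ hv2, mul_div_cancel₀ _ hv2]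
      conv_rhs => rw [hB v]
      abel
    · rintro ⟨z, rfl⟩
      change ¬ (B 2 + z.1 • B 1 + z.2 • B 0) ⬝ᵥ W 2 = 0
      simp [add_dotProduct, smul_dotProduct, hBW]
  · intro z z' h
    obtain ⟨a, ha⟩ := (Projectivization.mk_eq_mk_iff' ..).1 h
    have h2 : a = 1 := by
      simpa [add_dotProduct, smul_dotProduct, hBW] using congrArg (· ⬝ᵥ W 2) ha
    have h1 : a * z'.1 = z.1 := by
      simpa [add_dotProduct, smul_dotProduct, hBW] using congrArg (· ⬝ᵥ W 1) ha
    have h0 : a * z'.2 = z.2 := by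
      simpa [add_dotProduct, smul_dotProduct, hBW] using congrArg (· ⬝ᵥ W 0) ha
    rw [h2, one_mul] at h1 h0
    exact Prod.ext h1.symm h0.symm
  · intro m l
    constructor
    · intro hl
      induction l using Projectivization.ind with | h w hw =>
      have hm : (B 1 + m • B 0) ⬝ᵥ w = 0 := hl
      rw [add_dotProduct, smul_dotProduct, smul_eq_mul, add_eq_zero_iff_eq_neg] at hm
      have hwW := hW w
      rw [hm] at hwW
      by_cases h0 : B 0 ⬝ᵥ w = 0
      · rw [h0, mul_zero, neg_zero, zero_smul, zero_smul, zero_add, zero_add] at hwW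
        exact Or.inl ((Projectivization.mk_eq_mk_iff' ..).2 ⟨_, hwW.symm⟩)
      · refine Or.inr ⟨-(B 2 ⬝ᵥ w) / (B 0 ⬝ᵥ w),
          ((Projectivization.mk_eq_mk_iff' ..).2 ⟨B 0 ⬝ᵥ w, ?_⟩).symm⟩
        conv_rhs => rw [hwW]
        rw [smul_sub, smul_sub, smul_smul, smul_smul, mul_div_cancel₀ _ h0, neg_smul, neg_smul,
          sub_neg_eq_add, mul_comm m, sub_eq_add_neg]
    · rintro (rfl | ⟨b, rfl⟩)
      · change (B 1 + m • B 0) ⬝ᵥ W 2 = 0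
        simp [add_dotProduct, smul_dotProduct, hBW]
      · change (B 1 + m • B 0) ⬝ᵥ (W 0 - m • W 1 - b • W 2) = 0
        simp [add_dotProduct, smul_dotProduct, dotProduct_sub, dotProduct_smul, hBW]
  · intro m b z
    change (B 2 + z.1 • B 1 + z.2 • B 0) ⬝ᵥ (W 0 - m • W 1 - b • W 2) = 0 ↔ _
    have : (B 2 + z.1 • B 1 + z.2 • B 0) ⬝ᵥ (W 0 - m • W 1 - b • W 2) =
        z.2 - (m * z.1 + b) := by
      simp [add_dotProduct, smul_dotProduct, dotProduct_sub, dotProduct_smul, hBW]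
      ring
    rw [this, sub_eq_zero]
  · simp

end Desarguesian

/-! ### Distances in the incidence graph -/

section Distance

open Configuration

variable {P L : Type*} [Membership P L]

lemma incidenceGraph_adj_iff (l : L) (p : P) :
    (ProjPlane.incidenceGraph P L).Adj (Sum.inr l) (Sum.inl p) ↔ p ∈ l := by
  constructor
  · rintro ⟨x, m, hx, ⟨h, -⟩ | ⟨h1, h2⟩⟩
    · exact absurd h (by simp)
    · rw [Sum.inr.inj h1, Sum.inl.inj h2]; exact hx
  · exact fun h => ⟨p, l, h, Or.inr ⟨rfl, rfl⟩⟩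

/-- In a projective plane, a line and a point off it are at distance three. -/
lemma dist_incidenceGraph_of_notMem [Finite P] [Finite L] [ProjectivePlane P L] {l : L} {p : P}
    (h : p ∉ l) : (ProjPlane.incidenceGraph P L).dist (Sum.inr l) (Sum.inl p) = 3 := by
  obtain ⟨r, hr⟩ : ∃ r : P, r ∈ l := by
    have := ProjectivePlane.two_lt_pointCount (P := P) l
    obtain ⟨r⟩ := (Nat.card_pos_iff.1 (by rw [pointCount] at this; omega :
      0 < Nat.card {r : P // r ∈ l})).1
    exact ⟨r.1, r.2⟩
  obtain ⟨m, ⟨hrm, hpm⟩, -⟩ :=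
    HasLines.existsUnique_line P L r p fun hrp => h (hrp ▸ hr)
  let w : (ProjPlane.incidenceGraph P L).Walk (Sum.inr l) (Sum.inl p) :=
    .cons ((incidenceGraph_adj_iff l r).2 hr) (.cons ((incidenceGraph_adj_iff m r).2 hrm).symm
      (.cons ((incidenceGraph_adj_iff m p).2 hpm) .nil))
  have hle : (ProjPlane.incidenceGraph P L).dist (Sum.inr l) (Sum.inl p) ≤ 3 :=
    SimpleGraph.dist_le w
  obtain ⟨w', hw'⟩ := w.reachable.exists_walk_length_eq_dist
  -- no walk from a line to a point off it has length less than three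
  have hge : ∀ w' : (ProjPlane.incidenceGraph P L).Walk (Sum.inr l) (Sum.inl p),
      3 ≤ w'.length := by
    intro w'
    match w' with
    | .cons h1 .nil => exact absurd ((incidenceGraph_adj_iff l p).1 h1) h
    | .cons (v := x) h1 (.cons h2 .nil) =>
      obtain ⟨_, _, _, ⟨h3, _⟩ | ⟨_, h3⟩⟩ := h1
      · exact absurd h3 (by simp)
      · obtain ⟨_, _, _, ⟨_, h4⟩ | ⟨h4, _⟩⟩ := h2
        · exact absurd h4 (by simp)
        · exact absurd (h3.symm.trans h4) (by simp)
    | .cons _ (.cons _ (.cons _ w'')) => simp [SimpleGraph.Walk.length_cons]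
  have := hge w'
  omega

/-- Lines with the same trace on a semi-resolving set coincide. -/
lemma eq_of_forall_mem_iff_of_isSemiResolving [Finite P] [Finite L] [ProjectivePlane P L]
    {S : Set P} (hS : ProjPlane.IsSemiResolving L S) {l m : L}
    (h : ∀ p ∈ S, p ∈ l ↔ p ∈ m) : l = m := by
  refine hS l m fun p hp => ?_
  by_cases hl : p ∈ l
  · rw [SimpleGraph.dist_eq_one_iff_adj.2 ((incidenceGraph_adj_iff l p).2 hl),
      SimpleGraph.dist_eq_one_iff_adj.2 ((incidenceGraph_adj_iff m p).2 ((h p hp).1 hl))]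
  · rw [dist_incidenceGraph_of_notMem hl,
      dist_incidenceGraph_of_notMem fun hm => hl ((h p hp).2 hm)]

end Distance

/-! ### Semi-resolving sets -/

theorem mainTheorem3 {K : Type*} [Field K] [Finite K] (hq : 4 ≤ Nat.card K)
    (S : Set (ProjPlane.PGPoint K))
    (hS : ProjPlane.IsSemiResolving (ProjPlane.PGLine K) S)
    (hcard : (S.ncard : ℝ) < 2 * (Nat.card K : ℝ) + (Nat.card K : ℝ) / 4 - 3) :
    ∃ T : Set (ProjPlane.PGPoint K), T.encard ≤ 2 ∧
      ProjPlane.IsDoubleBlocking (ProjPlane.PGLine K) (S ∪ T) := by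
  classical
  have := Fintype.ofFinite K
  have := Fintype.ofFinite (ProjPlane.PGPoint K)
  obtain ⟨S, rfl⟩ : ∃ F : Finset (ProjPlane.PGPoint K), (F : Set _) = S :=
    ⟨S.toFinite.toFinset, S.toFinite.coe_toFinset⟩
  have horder : Configuration.ProjectivePlane.order (ProjPlane.PGPoint K) (ProjPlane.PGLine K) =
      Nat.card K := by
    obtain ⟨P, Q, hPQ⟩ := Fintype.exists_pair_of_one_lt_card (α := ProjPlane.PGPoint K) (by
      rw [Configuration.ProjectivePlane.card_points _ (ProjPlane.PGLine K)]
      exact (Configuration.ProjectivePlane.one_lt_order _ _).trans_le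
        ((Nat.le_add_left _ _).trans (Nat.le_succ _)))
    obtain ⟨c, -⟩ := exists_affineChart hPQ
    rw [c.order_eq_card, Nat.card_eq_fintype_card]
  have htrace : ∀ {l m : ProjPlane.PGLine K}, (S.filter fun p => p ∈ l) =
      (S.filter fun p => p ∈ m) → l = m := fun h =>
    eq_of_forall_mem_iff_of_isSemiResolving hS fun p hp => by
      simpa [Finset.mem_coe.1 hp] using Finset.ext_iff.1 h p
  have hskew : ∀ l m : ProjPlane.PGLine K, secantCount S l = 0 → secantCount S m = 0 → l = m := by
    intro l m hl hm
    exact htrace ((Finset.card_eq_zero.1 hl).trans (Finset.card_eq_zero.1 hm).symm)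
  have htan : ∀ p ∈ S, ∀ l m : ProjPlane.PGLine K, p ∈ l → p ∈ m → secantCount S l = 1 →
      secantCount S m = 1 → l = m := by
    intro p hp l m hpl hpm hl hm
    have hsingle : ∀ {k : ProjPlane.PGLine K}, p ∈ k → secantCount S k = 1 →
        (S.filter fun p => p ∈ k) = {p} := fun hpk hk => by
      obtain ⟨x, hx⟩ := Finset.card_eq_one.1 hk
      have hpx : p ∈ S.filter fun p => p ∈ _ := Finset.mem_filter.2 ⟨hp, hpk⟩
      rw [hx] at hpx ⊢
      rw [Finset.mem_singleton.1 hpx]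
    exact htrace ((hsingle hpl hl).trans (hsingle hpm hm).symm)
  have hcard' : 4 * S.card + 12 <
      9 * Configuration.ProjectivePlane.order (ProjPlane.PGPoint K) (ProjPlane.PGLine K) := by
    rw [horder]
    rw [Set.ncard_coe_finset] at hcard
    have : (4 * S.card + 12 : ℝ) < 9 * Nat.card K := by linarith
    exact_mod_cast this
  have hquad : ∀ p ∉ S, (pointIndex (ProjPlane.PGLine K) S p : ℤ) *
      (3 * Configuration.ProjectivePlane.order (ProjPlane.PGPoint K) (ProjPlane.PGLine K) + 1 -
        S.card - pointIndex (ProjPlane.PGLine K) S p) ≤ totalDeficiency (ProjPlane.PGLine K) S := by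
    intro p hp
    obtain ⟨l, hpl, hl⟩ := exists_two_le_secantCount (by omega)
      (totalDeficiency_le_card_add_two hskew htan) hp
    obtain ⟨r, hr⟩ := Finset.card_pos.1 (by change 0 < secantCount S l; omega :
      0 < (S.filter fun p => p ∈ l).card)
    obtain ⟨hrS, hrl⟩ := Finset.mem_filter.1 hr
    obtain ⟨c, rfl, rfl⟩ := exists_affineChart (P := p) (Q := r) fun h => hp (h ▸ hrS)
    have hlc : l = c.lineInf := by
      obtain ⟨m, -, hm⟩ := Configuration.HasLines.existsUnique_line (ProjPlane.PGPoint K)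
        (ProjPlane.PGLine K) _ _ (c.dir_ne 0)
      rw [hm l ⟨hpl, hrl⟩, hm c.lineInf ⟨(c.mem_lineInf_iff _).2 (Or.inr ⟨0, rfl⟩),
        (c.mem_lineInf_iff _).2 (Or.inl rfl)⟩]
    exact c.index_mul_le hrS (by rw [deficiency, ← hlc]; omega) hp
  obtain ⟨T, hT, hST⟩ := exists_doubly_blocking_extension hcard' hskew htan hquad
  refine ⟨T, ?_, fun l => ?_⟩
  · rw [Set.encard_coe_eq_coe_finsetCard]
    exact_mod_cast hT
  · obtain ⟨U, hU, hUl⟩ := hST l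
    calc (2 : ℕ∞) ≤ (U : Set (ProjPlane.PGPoint K)).encard := by
          rw [Set.encard_coe_eq_coe_finsetCard]
          exact_mod_cast hU
      _ ≤ _ := Set.encard_le_encard fun p hp => hUl p hp
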